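/- Let $m\in\mathbb Z\setminus\{0\}$ and let $\mathbb Z_m=\varprojlim_h \mathbb Z/m^h\mathbb Z$ be the topological ring of $m$-adic integers (the zero ring if $|m|=1$). For an integer $n$ let $BS(m,n)=\langle a,b\mid ab^ma^{-1}=b^n\rangle$, regarded as a group marked by $(a,b)$, i.e. as a point of the space $\mathcal G_2$ of groups marked by two generators, up to isomorphism of marked groups. The topology of $\mathcal G_2$ is given by the distance $e^{-\lambda}$ between distinct marked groups, where $\lambda$ is the length of a shortest word of the free group $\mathbb F_2$ that is trivial in exactly one of the two. For $\xi\in\mathbb Z_m$ let $$\overline{BS}(m,\xi)=\lim_{n\to\infty}BS(m,\xi_n)\in\mathcal G_2,$$ where $(\xi_n)_n$ is any sequence of rational integers with $\xi_n\to\xi$ in $\mathbb Z_m$ and $|\xi_n|\to\infty$; this limit exists and does not depend on the sequence. For $\xi\in\mathbb Z_m$, $\gcd(\xi,m)$ denotes the unique positive integer $d$ such that all prime factors of $d$ divide $m$ and the ideal of $\mathbb Z_m$ generated by $\xi$ and $m$ is $d\mathbb Z_m$; then $d$ divides $m$, and $\xi/d$ denotes the unique element $\xi'\in\mathbb Z_m$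 with $d\xi'=\xi$. Let $\xi,\eta\in\mathbb Z_m$. 1. The equality of marked groups $\overline{BS}(m,\xi)=\overline{BS}(m,\eta)$ holds if and only if there is a positive integer $d$ such that $\gcd(\xi,m)=\gcd(\eta,m)=d$ and the images of $\xi/d$ and $\eta/d$ under the canonical ring morphism $\mathbb Z_m\to\mathbb Z_{m/d}$ are equal. 2. If $\xi\neq\eta$ and no prime factor of $m$ divides both $\xi$ and $\eta$ in $\mathbb Z_m$, then $\overline{BS}(m,\xi)\neq\overline{BS}(m,\eta)$. Hence the map $\xi\mapsto\overline{BS}(m,\xi)$ is injective on the set of invertible $m$-adic integers. -/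

import Mathlib

open Filter Topology

/-! ### The ring of `m`-adic integers -/

/-- The projective limit of the rings `ℤ/m^hℤ`, as a subring of their product: the families
`(x_h)` that are compatible with the canonical projections. -/
def madicSubring (m : ℤ) : Subring (∀ h : ℕ, ZMod (m.natAbs ^ h)) where
  carrier := {x | ∀ (h k : ℕ) (hk : h ≤ k),
    ZMod.castHom (pow_dvd_pow m.natAbs hk) (ZMod (m.natAbs ^ h)) (x k) = x h}
  zero_mem' := fun h k hk => map_zero _
  one_mem' := fun h k hk => map_one _
  add_mem' := fun {x y} hx hy h k hk => by
    rw [Pi.add_apply, Pi.add_apply, map_add, hx h k hk, hy h k hk]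
  mul_mem' := fun {x y} hx hy h k hk => by
    rw [Pi.mul_apply, Pi.mul_apply, map_mul, hx h k hk, hy h k hk]
  neg_mem' := fun {x} hx h k hk => by
    rw [Pi.neg_apply, Pi.neg_apply, map_neg, hx h k hk]

/-- The ring `ℤ_m` of `m`-adic integers. Its topology is the projective limit topology, i.e. the
one induced from the product of the discrete rings `ℤ/m^hℤ`. -/
abbrev MadicInt (m : ℤ) : Type := madicSubring m

/-- The canonical ring morphism `ℤ_m → ℤ_{m'}` for `m' ∣ m`, induced by the projections
`ℤ/m^hℤ → ℤ/m'^hℤ`. -/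
def madicProj {m m' : ℤ} (hm : m' ∣ m) : MadicInt m →+* MadicInt m' where
  toFun x := ⟨fun h => ZMod.castHom (pow_dvd_pow_of_dvd (Int.natAbs_dvd_natAbs.mpr hm) h)
      (ZMod (m'.natAbs ^ h)) (x.1 h), fun h k hk => by
    beta_reduce
    rw [← x.2 h k hk]
    simp only [← RingHom.comp_apply]
    exact congrArg (fun f : ZMod (m.natAbs ^ k) →+* ZMod (m'.natAbs ^ h) => f (x.1 k))
      (RingHom.ext_zmod _ _)⟩
  map_zero' := Subtype.ext (funext fun h => map_zero _)
  map_one' := Subtype.ext (funext fun h => map_one _)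
  map_add' x y := Subtype.ext (funext fun h => map_add _ (x.1 h) (y.1 h))
  map_mul' x y := Subtype.ext (funext fun h => map_mul _ (x.1 h) (y.1 h))

/-- `d` is the greatest common divisor of the elements of `E ⊆ ℤ_m`: it is a positive integer
all of whose prime factors divide `m`, and it generates the ideal generated by `E`.
For `|m| = 1` this forces `d = 1`. -/
def IsMadicGcd {m : ℤ} (E : Set (MadicInt m)) (d : ℕ) : Prop :=
  0 < d ∧ (∀ p : ℕ, p.Prime → p ∣ d → (p : ℤ) ∣ m) ∧
    Ideal.span E = Ideal.span {(d : MadicInt m)}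

/-! ### The space of marked groups -/

/-- A marked group on `k` generators: a group with a generating family of length `k`. -/
structure MarkedGroup (k : ℕ) where
  carrier : Type
  [group : Group carrier]
  gens : Fin k → carrier
  closure_gens : Subgroup.closure (Set.range gens) = ⊤

attribute [instance] MarkedGroup.group

namespace MarkedGroup

variable {k : ℕ}

/-- The canonical homomorphism from the free group on `k` generators. -/
def hom (G : MarkedGroup k) : FreeGroup (Fin k) →* G.carrier := FreeGroup.lift G.gens

theorem hom_surjective (G : MarkedGroup k) : Function.Surjective G.hom := by
  rw [← MonoidHom.range_eq_top, hom, FreeGroup.range_lift_eq_closure, G.closure_gens]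

/-- Isomorphism of marked groups: a group isomorphism that respects the markings. -/
def Iso (G H : MarkedGroup k) : Prop :=
  ∃ e : G.carrier ≃* H.carrier, ∀ i, e (G.gens i) = H.gens i

theorem Iso.ker_eq {G H : MarkedGroup k} (h : G.Iso H) : G.hom.ker = H.hom.ker := by
  obtain ⟨e, he⟩ := h
  have h1 : e.toMonoidHom.comp G.hom = H.hom := by
    ext i
    simp [hom, he]
  ext w
  rw [MonoidHom.mem_ker, MonoidHom.mem_ker, ← h1]
  simp

theorem iso_of_ker_eq {G H : MarkedGroup k} (h : G.hom.ker = H.hom.ker) : G.Iso H := by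
  refine ⟨((QuotientGroup.quotientKerEquivOfSurjective G.hom G.hom_surjective).symm.trans
    (QuotientGroup.quotientMulEquivOfEq h)).trans
    (QuotientGroup.quotientKerEquivOfSurjective H.hom H.hom_surjective), fun i => ?_⟩
  have h1 : (QuotientGroup.quotientKerEquivOfSurjective G.hom G.hom_surjective).symm (G.gens i)
      = QuotientGroup.mk (FreeGroup.of i) := by
    rw [MulEquiv.symm_apply_eq]
    exact (FreeGroup.lift_apply_of (f := G.gens)).symm
  simp only [MulEquiv.trans_apply, h1]
  exact FreeGroup.lift_apply_of (f := H.gens)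

instance setoid (k : ℕ) : Setoid (MarkedGroup k) where
  r := Iso
  iseqv :=
    { refl := fun _ => iso_of_ker_eq rfl
      symm := fun h => iso_of_ker_eq h.ker_eq.symm
      trans := fun h h' => iso_of_ker_eq (h.ker_eq.trans h'.ker_eq) }

end MarkedGroup

/-- The set `𝒢_k` of marked groups on `k` generators up to isomorphism of marked groups. -/
def MarkedGroupSpace (k : ℕ) : Type 1 := Quotient (MarkedGroup.setoid k)

namespace MarkedGroupSpace

variable {k : ℕ}

/-- The class of a marked group. -/
def mk (G : MarkedGroup k) : MarkedGroupSpace k := Quotient.mk _ G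

/-- The words in the free group that vanish in a marked group. -/
def relations (G : MarkedGroupSpace k) : Subgroup (FreeGroup (Fin k)) :=
  Quotient.lift (fun H : MarkedGroup k => H.hom.ker)
    (fun _ _ h => MarkedGroup.Iso.ker_eq h) G

theorem relations_injective :
    Function.Injective (relations : MarkedGroupSpace k → Subgroup (FreeGroup (Fin k))) := by
  intro G H
  induction G using Quotient.inductionOn
  induction H using Quotient.inductionOn
  exact fun h => Quotient.sound (MarkedGroup.iso_of_ker_eq h)

/-- The lengths of the words that vanish in exactly one of two marked groups. -/
def diffLengths (G H : MarkedGroupSpace k) : Set ℕ :=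
  {n | ∃ w : FreeGroup (Fin k), w.norm = n ∧ ¬(w ∈ G.relations ↔ w ∈ H.relations)}

theorem diffLengths_comm (G H : MarkedGroupSpace k) : diffLengths G H = diffLengths H G := by
  simp only [diffLengths, iff_comm]

theorem diffLengths_nonempty {G H : MarkedGroupSpace k} (h : G ≠ H) :
    (diffLengths G H).Nonempty := by
  by_contra hne
  refine h (relations_injective (Subgroup.ext fun w => ?_))
  by_contra hw
  exact hne ⟨_, w, rfl, hw⟩

open Classical in
/-- The distance `e^{-λ}` between two distinct marked groups, where `λ` is the length of a
shortest word that vanishes in exactly one of them. -/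
noncomputable instance : Dist (MarkedGroupSpace k) where
  dist G H := if G = H then 0 else Real.exp (-(sInf (diffLengths G H) : ℕ))

theorem dist_of_ne {G H : MarkedGroupSpace k} (h : G ≠ H) :
    dist G H = Real.exp (-(sInf (diffLengths G H) : ℕ)) := if_neg h

theorem dist_self' (G : MarkedGroupSpace k) : dist G G = 0 := if_pos rfl

theorem dist_nonneg' (G H : MarkedGroupSpace k) : 0 ≤ dist G H := by
  by_cases h : G = H
  · rw [h, dist_self']
  · rw [dist_of_ne h]
    positivity

theorem dist_le_of_mem {G H : MarkedGroupSpace k} {n : ℕ} (h : n ∈ diffLengths G H) :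
    Real.exp (-(n : ℝ)) ≤ dist G H := by
  have hne : G ≠ H := by
    rintro rfl
    obtain ⟨w, -, hw⟩ := h
    exact hw Iff.rfl
  rw [dist_of_ne hne]
  have := Nat.sInf_le h
  gcongr

theorem dist_le_max (G H K : MarkedGroupSpace k) :
    dist G K ≤ max (dist G H) (dist H K) := by
  by_cases h : G = K
  · rw [h, dist_self']
    exact le_max_of_le_left (dist_nonneg' _ _)
  · obtain ⟨w, hn, hw⟩ := Nat.sInf_mem (diffLengths_nonempty h)
    rw [dist_of_ne h]
    by_cases h1 : w ∈ G.relations ↔ w ∈ H.relations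
    · exact le_max_of_le_right (dist_le_of_mem ⟨w, hn, fun h2 => hw (h1.trans h2)⟩)
    · exact le_max_of_le_left (dist_le_of_mem ⟨w, hn, h1⟩)

noncomputable instance : MetricSpace (MarkedGroupSpace k) where
  dist_self := dist_self'
  dist_comm G H := by
    by_cases h : G = H
    · rw [h]
    · rw [dist_of_ne h, dist_of_ne (Ne.symm h), diffLengths_comm]
  dist_triangle G H K := (dist_le_max G H K).trans
    (max_le_add_of_nonneg (dist_nonneg' _ _) (dist_nonneg' _ _))
  eq_of_dist_eq_zero {G H} h := by
    by_contra hne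
    rw [dist_of_ne hne] at h
    exact (Real.exp_pos _).ne' h

instance : Nonempty (MarkedGroupSpace k) :=
  ⟨mk ⟨FreeGroup (Fin k), FreeGroup.of, FreeGroup.closure_range_of _⟩⟩

end MarkedGroupSpace

/-! ### Baumslag-Solitar groups and their limits -/

/-- The Baumslag-Solitar group `⟨a, b | a b^m a⁻¹ = b^n⟩` marked by `(a, b)`, where the two free
generators `a` and `b` are numbered `0` and `1`. -/
def markedBS (m n : ℤ) : MarkedGroup 2 where
  carrier := PresentedGroup ({FreeGroup.of 0 * FreeGroup.of 1 ^ m * (FreeGroup.of 0)⁻¹ *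
    (FreeGroup.of 1 ^ n)⁻¹} : Set (FreeGroup (Fin 2)))
  gens := PresentedGroup.of
  closure_gens := PresentedGroup.closure_range_of _

/-- `BS(m, n)` as a point of `𝒢_2`. -/
def BS (m n : ℤ) : MarkedGroupSpace 2 := MarkedGroupSpace.mk (markedBS m n)

/-- `G` is the limit of `BS(m, x n)` for every sequence `x` of rational integers that tends to `ξ`
in `ℤ_m` and whose absolute values tend to infinity. -/
def IsBSLimit (m : ℤ) (ξ : MadicInt m) (G : MarkedGroupSpace 2) : Prop :=
  ∀ x : ℕ → ℤ, Tendsto (fun n => (x n : MadicInt m)) atTop (𝓝 ξ) →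
    Tendsto (fun n => |x n|) atTop atTop → Tendsto (fun n => BS m (x n)) atTop (𝓝 G)

/-- The marked group `lim BS(m, x n)`, for any `x` as in `IsBSLimit`. -/
noncomputable def BSbar (m : ℤ) (ξ : MadicInt m) : MarkedGroupSpace 2 :=
  Classical.epsilon (IsBSLimit m ξ)

/-!
The argument rests on a parallel run of Britton's algorithm in `BS(m, n)` and `BS(m, ν)`. A pinch
`a b^x a⁻¹` with `m ∣ x` is replaced by `b^(x n / m)`, and `a⁻¹ b^x a` with `n ∣ x` by
`b^(x m / n)`. Starting from a fixed word, all exponents are therefore values at `T = n / m` of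
polynomials in `ℤ[T]` for which Horner's scheme stays in the integers, with coefficients that are
bounded in terms of the word: the first rule multiplies the polynomial by `T`, and the second
divides it by `T`, because for large `|n|` the value is divisible by `n` only if the constant
coefficient vanishes. If `d` divides `m`, `n` and `ν`, then divisibility of such a value by `m` is
decided by the coefficients and by `n / d` modulo a power of `m / d`
(`Corresponding.dvd_iff`). So if `n / d` and `ν / d` are congruent modulo a high power of `m / d` and
`|n|`, `|ν|` are large, the same word is trivial in both groups or in none
(`exists_forall_mem_relations_iff`). The case `d = 1` yields the existence of the limits, and the
case `d = gcd(ξ, m)` one direction of the classification.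

For the converse, let `x₀ = b^m` and `x_{i+1} = a x_i a⁻¹ b^{c_i}`. By Britton's lemma
`a x_k a⁻¹` commutes with `b` in `BS(m, n)`, `|n| ≥ 2`, if and only if Horner's scheme at `n / m` for
the coefficients `m, c₀, c₁, …` stays in the integers for `k` steps
(`MarkedBS.hornerWord_mem_relations_iff`). For every `n` there are digits `c_i` in `[0, |m|)` that
achieve this. If the same digits work for `n` and `ν`, then one step shows that `n ≡ ν` modulo `m`,
so that `d = gcd(n, m) = gcd(ν, m)`, and `s + 1` steps improve a congruence between `n / d` and
`ν / d` modulo `(m / d)^s` to one modulo `(m / d)^(s + 1)`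
(`IsHornerIntegral.pow_succ_dvd_sub`).
-/

/-! ### Words and Britton's lemma in `BS(m, n)` -/

/-- The product of the syllables `a ^ u * b ^ x`, where `(u, x)` runs over a list. -/
def syllableProd {G : Type*} [Group G] (a b : G) (L : List (ℤˣ × ℤ)) : G :=
  (L.map fun p => a ^ (p.1 : ℤ) * b ^ p.2).prod

@[simp]
theorem syllableProd_nil {G : Type*} [Group G] (a b : G) : syllableProd a b [] = 1 := rfl

@[simp]
theorem syllableProd_cons {G : Type*} [Group G] (a b : G) (p : ℤˣ × ℤ) (L : List (ℤˣ × ℤ)) :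
    syllableProd a b (p :: L) = a ^ (p.1 : ℤ) * b ^ p.2 * syllableProd a b L := by
  simp [syllableProd]

@[simp]
theorem syllableProd_append {G : Type*} [Group G] (a b : G) (L L' : List (ℤˣ × ℤ)) :
    syllableProd a b (L ++ L') = syllableProd a b L * syllableProd a b L' := by
  simp [syllableProd]

theorem map_syllableProd {G H : Type*} [Group G] [Group H] (f : G →* H) (a b : G)
    (L : List (ℤˣ × ℤ)) : f (syllableProd a b L) = syllableProd (f a) (f b) L := by
  induction L with
  | nil => simp
  | cons p L ih => simp [ih]

/-- A list of syllables is reduced with respect to `(m, n)` if it has no subword `a b^x a⁻¹` with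
`m ∣ x` and no subword `a⁻¹ b^x a` with `n ∣ x`. -/
def IsReducedWord (m n : ℤ) (L : List (ℤˣ × ℤ)) : Prop :=
  L.IsChain fun p q => (if p.1 = 1 then m else n) ∣ p.2 → p.1 = q.1

theorem exists_pinch_of_not_isReducedWord {m n : ℤ} {L : List (ℤˣ × ℤ)}
    (h : ¬ IsReducedWord m n L) :
    ∃ L₁ u x y L₂, L = L₁ ++ (u, x) :: (-u, y) :: L₂ ∧ (if u = 1 then m else n) ∣ x := by
  rw [IsReducedWord, List.isChain_iff_forall_rel_of_append_cons_cons] at h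
  push Not at h
  obtain ⟨⟨u, x⟩, ⟨v, y⟩, L₁, L₂, rfl, hd, huv⟩ := h
  refine ⟨L₁, u, x, y, L₂, ?_, hd⟩
  have : v = -u := by
    rcases Int.units_eq_one_or u with rfl | rfl <;> rcases Int.units_eq_one_or v with rfl | rfl <;>
      simp_all
  rw [this]

namespace MarkedBS

open HNNExtension

/-- The stable letter `a` of `BS(m, n)`. -/
def a (m n : ℤ) : (markedBS m n).carrier := (markedBS m n).gens 0

/-- The generator `b` of the base group of `BS(m, n)`. -/
def b (m n : ℤ) : (markedBS m n).carrier := (markedBS m n).gens 1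

theorem a_mul_b_zpow_mul_inv (m n : ℤ) : a m n * b m n ^ m * (a m n)⁻¹ = b m n ^ n := by
  have h := PresentedGroup.one_of_mem (rels := ({FreeGroup.of 0 * FreeGroup.of 1 ^ m *
    (FreeGroup.of 0)⁻¹ * (FreeGroup.of 1 ^ n)⁻¹} : Set (FreeGroup (Fin 2)))) (Set.mem_singleton _)
  rw [map_mul, map_mul, map_mul, map_inv, map_inv, map_zpow, map_zpow] at h
  exact mul_inv_eq_one.1 h

theorem a_mul_b_zpow_mul (m n e : ℤ) :
    a m n * b m n ^ (m * e) * (a m n)⁻¹ = b m n ^ (n * e) := by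
  rw [zpow_mul, zpow_mul, ← a_mul_b_zpow_mul_inv, conj_zpow]

/-- Multiplication by `k` on the infinite cyclic group, written multiplicatively. -/
def mulHom (k : ℤ) : Multiplicative ℤ →* Multiplicative ℤ :=
  zpowersHom _ (Multiplicative.ofAdd k)

theorem mulHom_apply (k : ℤ) (x : Multiplicative ℤ) :
    mulHom k x = Multiplicative.ofAdd (k * x.toAdd) := by
  rw [mulHom, zpowersHom_apply, ← ofAdd_zsmul, smul_eq_mul, mul_comm]

theorem mulHom_injective {k : ℤ} (hk : k ≠ 0) : Function.Injective (mulHom k) := by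
  intro x y h
  rw [mulHom_apply, mulHom_apply] at h
  exact Multiplicative.toAdd.injective (mul_left_cancel₀ hk (Multiplicative.ofAdd.injective h))

theorem ofAdd_mem_range_mulHom {k x : ℤ} :
    Multiplicative.ofAdd x ∈ (mulHom k).range ↔ k ∣ x := by
  constructor
  · rintro ⟨j, hj⟩
    rw [mulHom_apply] at hj
    exact ⟨j.toAdd, (Multiplicative.ofAdd.injective hj).symm⟩
  · rintro ⟨j, rfl⟩
    exact ⟨Multiplicative.ofAdd j, mulHom_apply _ _⟩

section HNN

variable {m n : ℤ} (hm : m ≠ 0) (hn : n ≠ 0)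

/-- The isomorphism `mℤ ≃ nℤ` that takes `m` to `n`. -/
noncomputable def rangeEquiv : (mulHom m).range ≃* (mulHom n).range :=
  (MonoidHom.ofInjective (mulHom_injective hm)).symm.trans
    (MonoidHom.ofInjective (mulHom_injective hn))

theorem rangeEquiv_coe (x : ℤ) (hx : Multiplicative.ofAdd (m * x) ∈ (mulHom m).range) :
    (rangeEquiv hm hn ⟨Multiplicative.ofAdd (m * x), hx⟩ : Multiplicative ℤ) =
      Multiplicative.ofAdd (n * x) := by
  have h : (⟨Multiplicative.ofAdd (m * x), hx⟩ : (mulHom m).range) =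
      MonoidHom.ofInjective (mulHom_injective hm) (Multiplicative.ofAdd x) :=
    Subtype.ext (mulHom_apply _ _).symm
  rw [h, rangeEquiv, MulEquiv.trans_apply, MulEquiv.symm_apply_apply]
  exact mulHom_apply _ _

/-- The homomorphism from `BS(m, n)` to the HNN extension of `ℤ` along `m ↦ n`. -/
noncomputable def toHNN : (markedBS m n).carrier →*
    HNNExtension (Multiplicative ℤ) (mulHom m).range (mulHom n).range (rangeEquiv hm hn) :=
  PresentedGroup.toGroup (f := ![t, of (Multiplicative.ofAdd 1)]) (by
    rintro _ rfl
    have h := equiv_eq_conj (φ := rangeEquiv hm hn)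
      ⟨Multiplicative.ofAdd (m * 1), ofAdd_mem_range_mulHom.2 (dvd_mul_right _ _)⟩
    rw [rangeEquiv_coe hm hn] at h
    simp only [map_mul, map_inv, map_zpow, FreeGroup.lift_apply_of, Matrix.cons_val_zero,
      Matrix.cons_val_one, mul_inv_eq_one]
    simp only [← map_zpow, ← ofAdd_zsmul, smul_eq_mul]
    simpa using h.symm)

theorem toHNN_a : toHNN hm hn (a m n) = t := by
  exact PresentedGroup.toGroup.of _

theorem toHNN_b_zpow (x : ℤ) : toHNN hm hn (b m n ^ x) = of (Multiplicative.ofAdd x) := by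
  have h : toHNN hm hn (b m n) = of (Multiplicative.ofAdd 1) := PresentedGroup.toGroup.of _
  rw [map_zpow, h, ← map_zpow, ← ofAdd_zsmul, smul_eq_mul, mul_one]

/-- A reduced list of syllables as a reduced word of the HNN extension. -/
def reducedWord (h : ℤ) (L : List (ℤˣ × ℤ)) (hL : IsReducedWord m n L) :
    NormalWord.ReducedWord (Multiplicative ℤ) (mulHom m).range (mulHom n).range where
  head := Multiplicative.ofAdd h
  toList := L.map fun p => (p.1, Multiplicative.ofAdd p.2)
  chain := by
    rw [List.isChain_map]
    refine hL.imp fun p q hpq hp => hpq ?_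
    dsimp only at hp
    rcases Int.units_eq_one_or p.1 with h1 | h1
    · rw [h1, toSubgroup_one, ofAdd_mem_range_mulHom] at hp
      rwa [if_pos h1]
    · rw [h1, toSubgroup_neg_one, ofAdd_mem_range_mulHom] at hp
      rwa [h1, if_neg (by decide)]

theorem prod_reducedWord (h : ℤ) (L : List (ℤˣ × ℤ)) (hL : IsReducedWord m n L) :
    (reducedWord h L hL).prod (rangeEquiv hm hn) =
      toHNN hm hn (b m n ^ h * syllableProd (a m n) (b m n) L) := by
  rw [map_mul, toHNN_b_zpow, NormalWord.ReducedWord.prod, reducedWord]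
  congr 1
  simp only [List.map_map]
  induction L with
  | nil => simp
  | cons p L ih =>
    rw [List.map_cons, List.prod_cons, ih hL.tail, syllableProd_cons, map_mul, map_mul, map_zpow,
      toHNN_a, toHNN_b_zpow]
    rfl

end HNN

theorem b_zpow_eq_one {m n : ℤ} (hm : m ≠ 0) (hn : n ≠ 0) {h : ℤ} (hh : b m n ^ h = 1) : h = 0 := by
  have h1 := toHNN_b_zpow hm hn h
  rw [hh, map_one, ← map_one of] at h1
  exact (Multiplicative.ofAdd.injective (of_injective _ h1)).symm

/-- The uniqueness part of Britton's lemma: the leading powers of `b` of two reduced words that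
represent the same element and start, apart from that power, with `a`, differ by a power of
`b^n`. -/
theorem dvd_sub_of_reduced_eq {m n : ℤ} (hm : m ≠ 0) (hn : n ≠ 0) {h h' : ℤ}
    {L L' : List (ℤˣ × ℤ)} (hL : IsReducedWord m n L)
    (hL' : IsReducedWord m n L')
    (heq : b m n ^ h * syllableProd (a m n) (b m n) L =
      b m n ^ h' * syllableProd (a m n) (b m n) L')
    (x : ℤ) (hx : L.head? = some (1, x)) : n ∣ h' - h := by
  have h1 := (ReducedWord.map_fst_eq_and_of_prod_eq (rangeEquiv hm hn)
    (w₁ := reducedWord h L hL) (w₂ := reducedWord h' L' hL')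
    (by rw [prod_reducedWord, prod_reducedWord, heq])).2 1 (by simp [reducedWord, hx])
  rw [toSubgroup_neg_one] at h1
  have h2 : Multiplicative.ofAdd (h' - h) ∈ (mulHom n).range := by
    convert! h1 using 1
    rw [sub_eq_neg_add]
    rfl
  exact ofAdd_mem_range_mulHom.1 h2

/-- Britton's lemma: a word that represents the identity of `BS(m, n)` is empty or has a pinch. -/
theorem eq_nil_or_exists_pinch {m n : ℤ} (hm : m ≠ 0) (hn : n ≠ 0) {h : ℤ} {L : List (ℤˣ × ℤ)}
    (heq : b m n ^ h * syllableProd (a m n) (b m n) L = 1) :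
    (L = [] ∧ h = 0) ∨
      ∃ L₁ u x y L₂, L = L₁ ++ (u, x) :: (-u, y) :: L₂ ∧ (if u = 1 then m else n) ∣ x := by
  by_cases hL : IsReducedWord m n L
  · left
    have h1 := ReducedWord.toList_eq_nil_of_mem_of_range (rangeEquiv hm hn)
      (reducedWord h L hL) (by rw [prod_reducedWord, heq, map_one]; exact one_mem _)
    obtain rfl : L = [] := by simpa [reducedWord] using h1
    exact ⟨rfl, b_zpow_eq_one hm hn (by simpa using heq)⟩
  · exact Or.inr (exists_pinch_of_not_isReducedWord hL)

end MarkedBS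

/-! ### Corresponding exponents in `BS(m, n)` and `BS(m, ν)` -/

/-- The exponents `x` and `x'` have corresponding histories in `BS(m, n)` and `BS(m, ν)`: both are
the value at `T = n / m`, resp. `T = ν / m`, of the same polynomial
`c₀ + c₁ T + ⋯ + c_k T ^ k` with integer coefficients of absolute value at most `C`, where all
quotients that arise in Horner's scheme are integers. -/
def Corresponding (m n ν C : ℤ) : ℕ → ℤ → ℤ → Prop
  | 0, x, x' => x = x' ∧ |x| ≤ C
  | k + 1, x, x' => ∃ c e e' : ℤ, |c| ≤ C ∧ x = c + n * e ∧ x' = c + ν * e' ∧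
      Corresponding m n ν C k (m * e) (m * e')

namespace Corresponding

variable {m n ν C C' x x' y y' : ℤ} {k : ℕ}

theorem symm (h : Corresponding m n ν C k x x') : Corresponding m ν n C k x' x := by
  induction k generalizing x x' with
  | zero => exact ⟨h.1.symm, h.1 ▸ h.2⟩
  | succ k ih =>
    obtain ⟨c, e, e', hc, rfl, rfl, h⟩ := h
    exact ⟨c, e', e, hc, rfl, rfl, ih h⟩

theorem mono (hC : C ≤ C') (h : Corresponding m n ν C k x x') :
    Corresponding m n ν C' k x x' := by
  induction k generalizing x x' with
  | zero => exact ⟨h.1, h.2.trans hC⟩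
  | succ k ih =>
    obtain ⟨c, e, e', hc, rfl, rfl, h⟩ := h
    exact ⟨c, e, e', hc.trans hC, rfl, rfl, ih h⟩

theorem bound_nonneg (h : Corresponding m n ν C k x x') : 0 ≤ C := by
  cases k with
  | zero => exact (abs_nonneg _).trans h.2
  | succ k =>
    obtain ⟨c, e, e', hc, -⟩ := h
    exact (abs_nonneg _).trans hc

theorem succ (h : Corresponding m n ν C k x x') : Corresponding m n ν C (k + 1) x x' := by
  induction k generalizing x x' with
  | zero =>
    exact ⟨x, 0, 0, h.2, by simp, by simp [h.1], by simp, by simpa using h.bound_nonneg⟩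
  | succ k ih =>
    obtain ⟨c, e, e', hc, rfl, rfl, h⟩ := h
    exact ⟨c, e, e', hc, rfl, rfl, ih h⟩

theorem of_abs_le (h : |x| ≤ C) : Corresponding m n ν C k x x := by
  induction k with
  | zero => exact ⟨rfl, h⟩
  | succ k ih => exact ih.succ

theorem add (h : Corresponding m n ν C k x x') (h' : Corresponding m n ν C' k y y') :
    Corresponding m n ν (C + C') k (x + y) (x' + y') := by
  induction k generalizing x x' y y' with
  | zero =>
    obtain ⟨rfl, h⟩ := h
    obtain ⟨rfl, h'⟩ := h'
    exact ⟨rfl, (abs_add_le _ _).trans (add_le_add h h')⟩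
  | succ k ih =>
    obtain ⟨c, e, e', hc, rfl, rfl, h⟩ := h
    obtain ⟨d, f, f', hd, rfl, rfl, h'⟩ := h'
    refine ⟨c + d, e + f, e' + f', (abs_add_le _ _).trans (add_le_add hc hd), by ring, by ring, ?_⟩
    rw [mul_add, mul_add]
    exact ih h h'

/-- Every step of Horner's scheme divides by `m = d m'` and thus costs one power of `m'`, whereas
the factor `d` persists because it divides `n = d n'` and `ν = d ν'`. -/
theorem dvd_sub {d m' n' ν' : ℤ} {H s : ℕ} (hm : d * m' ≠ 0) (hH : m' ^ H ∣ n' - ν')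
    (hs : k + s ≤ H) (h : Corresponding (d * m') (d * n') (d * ν') C k x x') :
    d * m' ^ s ∣ x - x' := by
  induction k generalizing x x' s with
  | zero => simp [h.1]
  | succ k ih =>
    obtain ⟨c, e, e', -, rfl, rfl, h⟩ := h
    have h1 : d * m' * m' ^ s ∣ d * m' * (e - e') := by
      rw [mul_assoc, ← pow_succ', mul_sub]
      exact ih (by omega) h
    have h2 := Int.dvd_of_mul_dvd_mul_left hm h1
    have h3 : m' ^ s ∣ n' * (e - e') + (n' - ν') * e' :=
      dvd_add (h2.mul_left _) (((pow_dvd_pow m' (by omega)).trans hH).mul_right _)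
    have h4 := mul_dvd_mul_left d h3
    rwa [show d * (n' * (e - e') + (n' - ν') * e') = c + d * n' * e - (c + d * ν' * e') by ring]
      at h4

theorem dvd_iff {d m' n' ν' : ℤ} {H : ℕ} (hm : d * m' ≠ 0) (hH : m' ^ H ∣ n' - ν')
    (hk : k + 1 ≤ H) (h : Corresponding (d * m') (d * n') (d * ν') C k x x') :
    d * m' ∣ x ↔ d * m' ∣ x' := by
  have h1 := h.dvd_sub hm hH hk
  rw [pow_one] at h1
  exact (dvd_iff_dvd_of_dvd_sub h1)

/-- The exponents after the reduction of `a b^x a⁻¹`. -/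
theorem mul_n {e e' : ℤ} (h : Corresponding m n ν C k (m * e) (m * e')) :
    Corresponding m n ν C (k + 1) (n * e) (ν * e') :=
  ⟨0, e, e', by simpa using h.bound_nonneg, by simp, by simp, h⟩

/-- The exponents after the reduction of `a⁻¹ b^x a`. As `|n|` exceeds the coefficients, `n ∣ x`
forces the constant coefficient to vanish. -/
theorem exists_of_dvd (hn : C < |n|) (h : Corresponding m n ν C (k + 1) x x') (hx : n ∣ x) :
    ∃ e e', x = n * e ∧ x' = ν * e' ∧ Corresponding m n ν C k (m * e) (m * e') := by
  obtain ⟨c, e, e', hc, rfl, rfl, h⟩ := h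
  have h0 : c = 0 :=
    Int.eq_zero_of_abs_lt_dvd ((abs_dvd _ _).2 <| (Int.dvd_add_left (dvd_mul_right _ _)).1 hx)
      (hc.trans_lt hn)
  subst h0
  exact ⟨e, e', by simp, by simp, h⟩

theorem eq_zero (hm : m ≠ 0) (hn : C < |n|) (h : Corresponding m n ν C k 0 x') : x' = 0 := by
  induction k generalizing x' with
  | zero => exact h.1.symm
  | succ k ih =>
    have hn0 : n ≠ 0 := abs_pos.1 (h.bound_nonneg.trans_lt hn)
    obtain ⟨e, e', h1, rfl, h2⟩ := h.exists_of_dvd hn (dvd_zero _)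
    obtain rfl : e = 0 := by simpa [hn0] using h1.symm
    rw [mul_zero] at h2
    have := ih h2
    rw [mul_eq_zero, or_iff_right hm] at this
    simp [this]

end Corresponding

namespace MarkedBS

theorem pinch_eq {m n : ℤ} (u : ℤˣ) (e y : ℤ) :
    a m n ^ (u : ℤ) * b m n ^ ((if u = 1 then m else n) * e) *
      (a m n ^ ((-u : ℤˣ) : ℤ) * b m n ^ y) = b m n ^ ((if u = 1 then n else m) * e + y) := by
  have h := a_mul_b_zpow_mul m n e
  rcases Int.units_eq_one_or u with rfl | rfl
  · simp only [if_true, zpow_add, ← h]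
    simp [mul_assoc]
  · simp only [if_neg (show ¬ (-1 : ℤˣ) = 1 by decide), zpow_add, ← h]
    simp [mul_assoc]

/-- The syllable `(u, x)` of a pair `(u, x, x')` of syllables with the same sign. -/
abbrev fstSyl (p : ℤˣ × ℤ × ℤ) : ℤˣ × ℤ := (p.1, p.2.1)

/-- The syllable `(u, x')` of a pair `(u, x, x')` of syllables with the same sign. -/
abbrev sndSyl (p : ℤˣ × ℤ × ℤ) : ℤˣ × ℤ := (p.1, p.2.2)

/-- Britton reduction proceeds in parallel on two words whose exponents correspond: the first word
is trivial in `BS(m, n)` only if the second is trivial in `BS(m, ν)`. A reduction step removes two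
letters `a^{±1}`, adds up three exponents, whence the factor `3`, and may raise the degree `k` by
one. -/
theorem syllableProd_eq_one_of_corresponding {d m' n' ν' : ℤ} {H : ℕ} (hm : d * m' ≠ 0)
    (hH : m' ^ H ∣ n' - ν') (ℓ k : ℕ) (C h h' : ℤ) (L : List (ℤˣ × ℤ × ℤ)) (hℓ : L.length ≤ ℓ)
    (hk : k + ℓ + 1 ≤ H) (hC : 3 ^ ℓ * C < |d * n'|)
    (hh : Corresponding (d * m') (d * n') (d * ν') C k h h')
    (hL : ∀ p ∈ L, Corresponding (d * m') (d * n') (d * ν') C k p.2.1 p.2.2)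
    (heq : b (d * m') (d * n') ^ h *
      syllableProd (a (d * m') (d * n')) (b (d * m') (d * n')) (L.map fstSyl) = 1) :
    b (d * m') (d * ν') ^ h' *
      syllableProd (a (d * m') (d * ν')) (b (d * m') (d * ν')) (L.map sndSyl) = 1 := by
  have hC0 := hh.bound_nonneg
  have hC1 : C < |d * n'| :=
    lt_of_le_of_lt (le_mul_of_one_le_left hC0 (one_le_pow₀ (by norm_num))) hC
  have hn : d * n' ≠ 0 := abs_pos.1 (hC0.trans_lt hC1)
  induction ℓ generalizing k C h h' L with
  | zero =>
    obtain rfl : L = [] := List.eq_nil_of_length_eq_zero (by omega)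
    obtain rfl := b_zpow_eq_one hm hn (by simpa using heq)
    simp [hh.eq_zero hm hC1]
  | succ ℓ ih =>
    rcases eq_nil_or_exists_pinch hm hn heq with ⟨hnil, rfl⟩ | ⟨L₁, u, x, y, L₂, hsplit, hdvd⟩
    · obtain rfl : L = [] := by simpa using hnil
      simp [hh.eq_zero hm hC1]
    obtain ⟨L₁, L', rfl, rfl, h2⟩ := List.map_eq_append_iff.1 hsplit
    obtain ⟨⟨u, x, x'⟩, L', rfl, h3, h2⟩ := List.map_eq_cons_iff.1 h2
    obtain ⟨⟨u', y, y'⟩, L₂, rfl, h4, rfl⟩ := List.map_eq_cons_iff.1 h2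
    obtain ⟨rfl, rfl⟩ := Prod.mk.inj h3
    obtain ⟨h4, rfl⟩ := Prod.mk.inj h4
    dsimp only at h4 hdvd heq
    obtain rfl : u' = -u := congrArg Prod.fst h4
    have hx := hL (u, x, x') (by simp)
    have hy := (hL (-u, y, y') (by simp)).succ
    dsimp only at hx hy
    obtain ⟨e, e', rfl, rfl, hz⟩ : ∃ e e', x = (if u = 1 then d * m' else d * n') * e ∧
        x' = (if u = 1 then d * m' else d * ν') * e' ∧
        Corresponding (d * m') (d * n') (d * ν') C (k + 1) ((if u = 1 then d * n' else d * m') * e)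
          ((if u = 1 then d * ν' else d * m') * e') := by
      split_ifs at hdvd ⊢ with hu
      · obtain ⟨e', rfl⟩ := (hx.dvd_iff hm hH (by omega)).1 hdvd
        obtain ⟨e, rfl⟩ := hdvd
        exact ⟨e, e', rfl, rfl, hx.mul_n⟩
      · obtain ⟨e, e', h5, h6, h7⟩ := hx.succ.exists_of_dvd hC1 hdvd
        exact ⟨e, e', h5, h6, h7.succ⟩
    have hzy := hz.add hy
    have h3C : 3 ^ ℓ * (3 * C) < |d * n'| := by
      rwa [← mul_assoc, ← pow_succ]
    have h3C1 : 3 * C < |d * n'| :=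
      lt_of_le_of_lt (le_mul_of_one_le_left (by omega) (one_le_pow₀ (by norm_num))) h3C
    -- the exponent that a pinch leaves behind is absorbed by the syllable in front of it
    rcases List.eq_nil_or_concat' L₁ with rfl | ⟨L₁, ⟨v, w, w'⟩, rfl⟩
    · have := ih (k + 1) (3 * C) (h + ((if u = 1 then d * n' else d * m') * e + y))
        (h' + ((if u = 1 then d * ν' else d * m') * e' + y')) L₂ (by simp at hℓ; omega) (by omega)
        h3C ((hh.succ.add hzy).mono (by omega))
        (fun p hp => ((hL p (by simp [hp])).succ).mono (by omega))
        (by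
          rw [zpow_add, ← pinch_eq u e y]
          simpa [mul_assoc] using heq) (by omega) h3C1
      rw [zpow_add, ← pinch_eq u e' y'] at this
      simpa [mul_assoc] using this
    · have hw := (hL (v, w, w') (by simp)).succ
      have := ih (k + 1) (3 * C) h h'
        (L₁ ++ (v, w + ((if u = 1 then d * n' else d * m') * e + y),
          w' + ((if u = 1 then d * ν' else d * m') * e' + y')) :: L₂)
        (by simp at hℓ ⊢; omega) (by omega)
        h3C (hh.succ.mono (by omega))
        (by
          intro p hp
          rw [List.mem_append, List.mem_cons] at hp
          rcases hp with hp | rfl | hp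
          · exact ((hL p (by simp [hp])).succ).mono (by omega)
          · exact (hw.add hzy).mono (by omega)
          · exact ((hL p (by simp [hp])).succ).mono (by omega))
        (by
          simp only [List.map_append, List.map_cons, syllableProd_append, syllableProd_cons]
          rw [zpow_add _ w, ← pinch_eq u e y]
          simpa [mul_assoc] using heq) (by omega) h3C1
      simp only [List.map_append, List.map_cons, syllableProd_append, syllableProd_cons] at this
      rw [zpow_add _ w', ← pinch_eq u e' y'] at this
      simpa [mul_assoc] using this

end MarkedBS

/-- Every word in two letters is a power of `b` followed by syllables `a ^ u * b ^ x`. -/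
theorem FreeGroup.exists_syllables (w : FreeGroup (Fin 2)) :
    ∃ (h : ℤ) (L : List (ℤˣ × ℤ)), w =
      FreeGroup.of 1 ^ h * syllableProd (FreeGroup.of 0) (FreeGroup.of 1) L := by
  induction w using FreeGroup.induction_on with
  | C1 => exact ⟨0, [], by simp⟩
  | of i =>
    fin_cases i
    · exact ⟨0, [(1, 0)], by simp⟩
    · exact ⟨1, [], by simp⟩
  | inv_of i _ =>
    fin_cases i
    · exact ⟨0, [(-1, 0)], by simp⟩
    · exact ⟨-1, [], by simp⟩
  | mul v w hv hw =>
    obtain ⟨h, L, rfl⟩ := hv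
    obtain ⟨h', L', rfl⟩ := hw
    rcases List.eq_nil_or_concat' L with rfl | ⟨L, ⟨u, x⟩, rfl⟩
    · exact ⟨h + h', L', by simp [zpow_add, mul_assoc]⟩
    · exact ⟨h, L ++ (u, x + h') :: L', by simp [zpow_add, mul_assoc]⟩

theorem mem_relations_BS {m n : ℤ} {w : FreeGroup (Fin 2)} :
    w ∈ (BS m n).relations ↔ (markedBS m n).hom w = 1 := Iff.rfl

theorem hom_syllables (m n h : ℤ) (L : List (ℤˣ × ℤ)) :
    (markedBS m n).hom (FreeGroup.of 1 ^ h * syllableProd (FreeGroup.of 0) (FreeGroup.of 1) L) =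
      MarkedBS.b m n ^ h * syllableProd (MarkedBS.a m n) (MarkedBS.b m n) L := by
  rw [map_mul, map_zpow, map_syllableProd]
  simp only [MarkedGroup.hom, FreeGroup.lift_apply_of]
  rfl

/-- Whether a given word is trivial in `BS(m, n)` depends, for `|n|` large and a common divisor `d`
of `m` and `n`, only on the class of `n / d` modulo a power of `m / d`. -/
theorem exists_forall_mem_relations_iff (w : FreeGroup (Fin 2)) :
    ∃ (H : ℕ) (B : ℤ), ∀ d m' n' ν' : ℤ, d * m' ≠ 0 → m' ^ H ∣ n' - ν' → B < |d * n'| →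
      B < |d * ν'| → (w ∈ (BS (d * m') (d * n')).relations ↔
        w ∈ (BS (d * m') (d * ν')).relations) := by
  obtain ⟨h, L, rfl⟩ := FreeGroup.exists_syllables w
  obtain ⟨C, hC⟩ : ∃ C : ℤ, |h| ≤ C ∧ ∀ p ∈ L, |p.2| ≤ C := by
    induction L with
    | nil => exact ⟨|h|, le_rfl, by simp⟩
    | cons p L ih =>
      obtain ⟨C, h1, h2⟩ := ih
      refine ⟨max C |p.2|, le_max_of_le_left h1, fun q hq => ?_⟩
      rcases List.mem_cons.1 hq with rfl | hq
      · exact le_max_right _ _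
      · exact le_max_of_le_left (h2 q hq)
  have key : ∀ d m' n' ν' : ℤ, d * m' ≠ 0 → m' ^ (L.length + 1) ∣ n' - ν' →
      3 ^ L.length * C < |d * n'| →
      MarkedBS.b (d * m') (d * n') ^ h *
        syllableProd (MarkedBS.a (d * m') (d * n')) (MarkedBS.b (d * m') (d * n')) L = 1 →
      MarkedBS.b (d * m') (d * ν') ^ h *
        syllableProd (MarkedBS.a (d * m') (d * ν')) (MarkedBS.b (d * m') (d * ν')) L = 1 := by
    intro d m' n' ν' hm hH hn heq
    have := MarkedBS.syllableProd_eq_one_of_corresponding hm hH L.length 0 C h h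
      (L.map fun p => (p.1, p.2, p.2)) (by simp) (by omega) hn (.of_abs_le hC.1)
      (by
        intro p hp
        obtain ⟨q, hq, rfl⟩ := List.mem_map.1 hp
        exact .of_abs_le (hC.2 q hq))
      (by simpa [Function.comp_def] using heq)
    simpa [Function.comp_def] using this
  refine ⟨L.length + 1, 3 ^ L.length * C, fun d m' n' ν' hm hH hn hν => ?_⟩
  rw [mem_relations_BS, mem_relations_BS, hom_syllables, hom_syllables]
  exact ⟨key d m' n' ν' hm hH hn, key d m' ν' n' hm ((dvd_sub_comm).1 hH) hν⟩

/-! ### Words that detect the parameters -/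

/-- The elements `x₀ = b^m`, `x_{i+1} = a x_i a⁻¹ b^{c_i}`. -/
def hornerElt {G : Type*} [Group G] (a b : G) (m : ℤ) (c : ℕ → ℤ) : ℕ → G
  | 0 => b ^ m
  | i + 1 => a * hornerElt a b m c i * a⁻¹ * b ^ c i

theorem map_hornerElt {G H : Type*} [Group G] [Group H] (f : G →* H) (a b : G) (m : ℤ)
    (c : ℕ → ℤ) (k : ℕ) : f (hornerElt a b m c k) = hornerElt (f a) (f b) m c k := by
  induction k with
  | zero => simp [hornerElt]
  | succ k ih => simp [hornerElt, ih]

open FreeGroup in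
/-- The commutator of `a x_k a⁻¹` and `b`, where `x_k` is as in `hornerElt`. -/
def hornerWord (m : ℤ) (c : ℕ → ℤ) (k : ℕ) : FreeGroup (Fin 2) :=
  of 0 * hornerElt (of 0) (of 1) m c k * (of 0)⁻¹ * of 1 *
    (of 0 * hornerElt (of 0) (of 1) m c k * (of 0)⁻¹)⁻¹ * (of 1)⁻¹

/-- Horner's scheme at `n / m` for the polynomial with leading coefficient `m` and further
coefficients `c₀, c₁, …` can be carried out for `k` steps in the integers: all values of the scheme
are divisible by `m`, and `e i` are the quotients. -/
def IsHornerIntegral (m n : ℤ) (c : ℕ → ℤ) (k : ℕ) : Prop :=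
  ∃ e : ℕ → ℤ, e 0 = 1 ∧ ∀ i < k, m * e (i + 1) = n * e i + c i

namespace MarkedBS

variable {m n : ℤ}

/-- The element `g` has a reduced expression that starts with `a` and ends with `a⁻¹ b^x`. -/
def StartsUpEndsDown (m n : ℤ) (g : (markedBS m n).carrier) : Prop :=
  ∃ (x y : ℤ) (L : List (ℤˣ × ℤ)), IsReducedWord m n ((1, x) :: (L ++ [(-1, y)])) ∧
    g = syllableProd (a m n) (b m n) ((1, x) :: (L ++ [(-1, y)]))

theorem StartsUpEndsDown.base {v : ℤ} (hv : ¬ m ∣ v) (y : ℤ) :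
    StartsUpEndsDown m n (a m n * b m n ^ v * (a m n)⁻¹ * b m n ^ y) :=
  ⟨v, y, [], by simp [IsReducedWord, hv], by simp [mul_assoc]⟩

theorem StartsUpEndsDown.step {g : (markedBS m n).carrier} (hg : StartsUpEndsDown m n g) (y : ℤ) :
    StartsUpEndsDown m n (a m n * g * (a m n)⁻¹ * b m n ^ y) := by
  obtain ⟨x, z, L, hL, rfl⟩ := hg
  refine ⟨0, y, (1, x) :: (L ++ [(-1, z)]), ?_, by simp [mul_assoc]⟩
  refine List.IsChain.cons_cons (fun _ => rfl) ?_
  have := List.IsChain.append (l₂ := [((-1 : ℤˣ), y)]) hL (by simp) (by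
    rw [← List.cons_append, List.getLast?_concat]
    simp +contextual)
  simpa using this

/-- If `g` commuted with `b`, then the reduced words for `g b` and for `b g` would represent the same
element, although their leading powers of `b` are `b^0` and `b^1`. -/
theorem not_commute_of_startsUpEndsDown (hm : m ≠ 0) (hn : 2 ≤ |n|) {g : (markedBS m n).carrier}
    (h : ∀ y : ℤ, StartsUpEndsDown m n (g * b m n ^ y)) : ¬ Commute g (b m n) := by
  intro hc
  obtain ⟨x, y, L, hL, h1⟩ := h 1
  obtain ⟨x', y', L', hL', h2⟩ := h 0
  rw [zpow_zero, mul_one] at h2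
  have h3 := dvd_sub_of_reduced_eq hm (by rintro rfl; simp at hn) (h := 0) (h' := 1) hL hL'
    (by rw [← h1, ← h2, zpow_zero, one_mul, zpow_one]; exact hc) x rfl
  rw [sub_zero, ← isUnit_iff_dvd_one, Int.isUnit_iff_abs_eq] at h3
  omega

theorem hornerElt_eq {c : ℕ → ℤ} {k : ℕ} {e : ℕ → ℤ} (h0 : e 0 = 1)
    (he : ∀ i < k, m * e (i + 1) = n * e i + c i) :
    hornerElt (a m n) (b m n) m c k = b m n ^ (m * e k) := by
  induction k with
  | zero => simp [hornerElt, h0]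
  | succ k ih =>
    rw [hornerElt, ih fun i hi => he i (by omega), a_mul_b_zpow_mul, ← zpow_add, he k (by omega)]

theorem commute_hornerElt {c : ℕ → ℤ} {k : ℕ} (h : IsHornerIntegral m n c k) :
    Commute (a m n * hornerElt (a m n) (b m n) m c k * (a m n)⁻¹) (b m n) := by
  obtain ⟨e, h0, he⟩ := h
  rw [hornerElt_eq h0 he, a_mul_b_zpow_mul]
  exact (Commute.refl _).zpow_left _

/-- Once a step of Horner's scheme leaves the integers, the elements `x_k` leave `⟨b⟩`. -/
theorem startsUpEndsDown_of_not_isHornerIntegral {c : ℕ → ℤ} {k : ℕ}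
    (h : ¬ IsHornerIntegral m n c k) (y : ℤ) :
    StartsUpEndsDown m n
      (a m n * hornerElt (a m n) (b m n) m c k * (a m n)⁻¹ * b m n ^ y) := by
  induction k generalizing y with
  | zero => exact absurd ⟨fun _ => 1, rfl, by simp⟩ h
  | succ k ih =>
    by_cases hk : IsHornerIntegral m n c k
    · obtain ⟨e, h0, he⟩ := hk
      rw [hornerElt, hornerElt_eq h0 he, a_mul_b_zpow_mul, ← zpow_add]
      refine StartsUpEndsDown.base (fun ⟨f, hf⟩ => h ?_) y
      refine ⟨fun i => if i ≤ k then e i else f, by simp [h0], fun i hi => ?_⟩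
      rcases Nat.lt_succ_iff_lt_or_eq.1 hi with hi | rfl
      · simp [he i hi, hi.le, Nat.succ_le_of_lt hi]
      · simp [hf]
    · exact (ih hk _).step y

theorem hornerWord_mem_relations_iff (hm : m ≠ 0) (hn : 2 ≤ |n|) (c : ℕ → ℤ) (k : ℕ) :
    hornerWord m c k ∈ (BS m n).relations ↔ IsHornerIntegral m n c k := by
  have h1 : (markedBS m n).hom (hornerWord m c k) = 1 ↔
      Commute (a m n * hornerElt (a m n) (b m n) m c k * (a m n)⁻¹) (b m n) := by
    simp only [hornerWord, map_mul, map_inv, map_hornerElt, MarkedGroup.hom,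
      FreeGroup.lift_apply_of]
    rw [mul_inv_eq_one, mul_inv_eq_iff_eq_mul]
    rfl
  rw [mem_relations_BS, h1]
  refine ⟨fun h => ?_, commute_hornerElt⟩
  by_contra hk
  exact not_commute_of_startsUpEndsDown hm hn (startsUpEndsDown_of_not_isHornerIntegral hk) h

end MarkedBS

namespace IsHornerIntegral

/-- The coefficients can be chosen one after the other, as digits, so that Horner's scheme stays
in the integers. -/
theorem exists_digits {m : ℤ} (hm : m ≠ 0) (n : ℤ) :
    ∃ c : ℕ → ℤ, (∀ i, 0 ≤ c i ∧ c i < |m|) ∧ ∀ k, IsHornerIntegral m n c k := by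
  let e : ℕ → ℤ := fun i => Nat.rec 1 (fun _ x => (n * x + (-(n * x)) % m) / m) i
  refine ⟨fun i => (-(n * e i)) % m, fun i => ⟨Int.emod_nonneg _ hm, Int.emod_lt_abs _ hm⟩,
    fun k => ⟨e, rfl, fun i _ => ?_⟩⟩
  refine Int.mul_ediv_cancel' ((Int.dvd_iff_emod_eq_zero).2 ?_)
  rw [Int.add_emod, Int.emod_emod, ← Int.add_emod, add_neg_cancel, Int.zero_emod]

theorem congr {m n : ℤ} {c c' : ℕ → ℤ} {k : ℕ} (h : ∀ i < k, c i = c' i)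
    (hc : IsHornerIntegral m n c k) : IsHornerIntegral m n c' k := by
  obtain ⟨e, h0, he⟩ := hc
  exact ⟨e, h0, fun i hi => by rw [he i hi, h i hi]⟩

theorem dvd_sub_one {m n ν : ℤ} {c : ℕ → ℤ} (h : IsHornerIntegral m n c 1)
    (h' : IsHornerIntegral m ν c 1) : m ∣ n - ν := by
  obtain ⟨e, h0, he⟩ := h
  obtain ⟨f, g0, hf⟩ := h'
  have h1 := he 0 one_pos
  have h2 := hf 0 one_pos
  rw [h0] at h1
  rw [g0] at h2
  exact ⟨e 1 - f 1, by linear_combination h2 - h1⟩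

/-- If Horner's scheme stays in the integers for `s + 1` steps both at `n' / m'` and at `ν' / m'`,
then a congruence of `n'` and `ν'` modulo `m' ^ s` improves to one modulo `m' ^ (s + 1)`. -/
theorem pow_succ_dvd_sub {d m' n' ν' : ℤ} {c : ℕ → ℤ} {s : ℕ} (hd : d ≠ 0)
    (hcop : IsCoprime m' n') (h : IsHornerIntegral (d * m') (d * n') c (s + 1))
    (h' : IsHornerIntegral (d * m') (d * ν') c (s + 1)) (hs : m' ^ s ∣ n' - ν') :
    m' ^ (s + 1) ∣ n' - ν' := by
  obtain ⟨e, e0, he⟩ := h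
  obtain ⟨f, f0, hf⟩ := h'
  have hstep : ∀ i < s + 1, m' * (e (i + 1) - f (i + 1)) =
      n' * (e i - f i) + (n' - ν') * f i := fun i hi =>
    mul_left_cancel₀ hd (by linear_combination he i hi - hf i hi)
  -- descending from the last step, the differences `e i - f i` are divisible by ever higher powers
  have hdiv : ∀ j ≤ s, m' ^ j ∣ e (s + 1 - j) - f (s + 1 - j) := by
    intro j hj
    induction j with
    | zero => simp
    | succ j ih =>
      have h1 := ih (by omega)
      have h2 := hstep (s - j) (by omega)
      rw [show s - j + 1 = s + 1 - j by omega] at h2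
      have h3 : m' ^ (j + 1) ∣ n' * (e (s - j) - f (s - j)) := by
        rw [← Int.dvd_add_left (((pow_dvd_pow m' hj).trans hs).mul_right (f (s - j))), ← h2,
          pow_succ']
        exact mul_dvd_mul_left _ h1
      rw [show s + 1 - (j + 1) = s - j by omega]
      exact hcop.pow_left.dvd_of_dvd_mul_left h3
  have h1 := hstep 0 (by omega)
  rw [e0, f0, sub_self, mul_zero, mul_one, zero_add (n' - ν')] at h1
  rw [← h1, pow_succ']
  have h2 := hdiv s le_rfl
  rw [show s + 1 - s = 0 + 1 by omega] at h2
  exact mul_dvd_mul_left _ h2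

end IsHornerIntegral

/-! ### Convergence in the space of marked groups -/

namespace MarkedGroupSpace

/-- A sequence of marked groups converges if and only if, for every word, the groups in which the
word is trivial are eventually in accordance with the limit. -/
theorem tendsto_iff {k : ℕ} {ι : Type*} {l : Filter ι} {F : ι → MarkedGroupSpace k}
    {G : MarkedGroupSpace k} :
    Tendsto F l (𝓝 G) ↔
      ∀ w : FreeGroup (Fin k), ∀ᶠ i in l, (w ∈ (F i).relations ↔ w ∈ G.relations) := by
  rw [Metric.tendsto_nhds]
  constructor
  · intro h w
    filter_upwards [h _ (Real.exp_pos (-(w.norm : ℝ)))] with i hi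
    by_contra hw
    exact absurd hi (dist_le_of_mem ⟨w, rfl, hw⟩).not_gt
  · intro h ε hε
    obtain ⟨N, hN⟩ : ∃ N : ℕ, Real.exp (-(N : ℝ)) < ε :=
      ((Real.tendsto_exp_neg_atTop_nhds_zero.comp tendsto_natCast_atTop_atTop).eventually
        (gt_mem_nhds hε)).exists
    have hfin : {w : FreeGroup (Fin k) | w.norm ≤ N}.Finite :=
      Set.Finite.of_finite_image ((List.finite_length_le _ N).subset (by
        rintro _ ⟨w, hw, rfl⟩
        exact hw)) FreeGroup.toWord_injective.injOn
    filter_upwards [(Filter.eventually_all_finite hfin).2 fun w _ => h w] with i hi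
    by_cases hne : F i = G
    · rwa [hne, dist_self]
    · refine lt_of_le_of_lt ?_ hN
      rw [dist_of_ne hne]
      obtain ⟨w, hw, hw'⟩ := Nat.sInf_mem (diffLengths_nonempty hne)
      have : N ≤ sInf (diffLengths (F i) G) := by
        by_contra hlt
        exact hw' (hi w (hw.trans_le (not_le.1 hlt).le))
      gcongr

/-- Every normal subgroup of the free group is the set of relations of a marked group. -/
theorem exists_relations_eq {k : ℕ} (R : Subgroup (FreeGroup (Fin k))) [R.Normal] :
    ∃ G : MarkedGroupSpace k, G.relations = R := by
  refine ⟨mk ⟨FreeGroup (Fin k) ⧸ R, fun i => QuotientGroup.mk' R (FreeGroup.of i), ?_⟩, ?_⟩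
  · rw [Set.range_comp' (QuotientGroup.mk' R), ← MonoidHom.map_closure,
      FreeGroup.closure_range_of, ← MonoidHom.range_eq_map, MonoidHom.range_eq_top]
    exact QuotientGroup.mk'_surjective R
  · have h : FreeGroup.lift (fun i => QuotientGroup.mk' R (FreeGroup.of i)) =
        QuotientGroup.mk' R := by
      ext i
      simp
    change MonoidHom.ker (FreeGroup.lift _) = R
    rw [h, QuotientGroup.ker_mk']

instance normal_relations {k : ℕ} (G : MarkedGroupSpace k) : G.relations.Normal := by
  induction G using Quotient.inductionOn with
  | h G => exact inferInstanceAs (MonoidHom.ker G.hom).Normal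

/-- A sequence of marked groups converges as soon as every word is eventually trivial or eventually
nontrivial. -/
theorem exists_tendsto {k : ℕ} {F : ℕ → MarkedGroupSpace k}
    (h : ∀ w : FreeGroup (Fin k), ∃ N, ∀ i ≥ N, ∀ j ≥ N,
      w ∈ (F i).relations → w ∈ (F j).relations) :
    ∃ G, Tendsto F atTop (𝓝 G) := by
  let R : Subgroup (FreeGroup (Fin k)) :=
    { carrier := {w | ∀ᶠ i in atTop, w ∈ (F i).relations}
      one_mem' := Eventually.of_forall fun i => one_mem _
      mul_mem' := fun hv hw => by
        filter_upwards [hv, hw] with i hv hw using mul_mem hv hw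
      inv_mem' := fun hw => by
        filter_upwards [hw] with i hw using inv_mem hw }
  have hR : R.Normal := ⟨fun w hw g => by
    filter_upwards [show ∀ᶠ i in atTop, w ∈ (F i).relations from hw] with i hw
      using (normal_relations _).conj_mem w hw g⟩
  obtain ⟨G, hG⟩ := exists_relations_eq R
  refine ⟨G, tendsto_iff.2 fun w => ?_⟩
  rw [hG]
  obtain ⟨N, hN⟩ := h w
  filter_upwards [eventually_ge_atTop N] with i hi
  refine ⟨fun hw => ?_, fun hw => ?_⟩
  · exact eventually_atTop.2 ⟨N, fun j hj => hN i hi j hj hw⟩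
  · obtain ⟨j, hj, hw⟩ := ((eventually_ge_atTop N).and
      (show ∀ᶠ i in atTop, w ∈ (F i).relations from hw)).exists
    exact hN j hj i hi hw

end MarkedGroupSpace

/-! ### Rational integers and `m`-adic integers -/

namespace MadicInt

variable {m : ℤ}

@[ext]
theorem ext {ξ η : MadicInt m} (h : ∀ k, ξ.1 k = η.1 k) : ξ = η := Subtype.ext (funext h)

theorem intCast_apply (z : ℤ) (k : ℕ) : (z : MadicInt m).1 k = z := rfl

theorem intCast_eq_iff_dvd {k : ℕ} {x y : ℤ} :
    (x : ZMod (m.natAbs ^ k)) = y ↔ m ^ k ∣ x - y := by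
  rw [← sub_eq_zero, ← Int.cast_sub, ZMod.intCast_zmod_eq_zero_iff_dvd, ← Int.natAbs_pow,
    Int.natAbs_dvd]

theorem tendsto_iff {x : ℕ → ℤ} {ξ : MadicInt m} :
    Tendsto (fun i => (x i : MadicInt m)) atTop (𝓝 ξ) ↔
      ∀ k, ∀ᶠ i in atTop, (x i : ZMod (m.natAbs ^ k)) = ξ.1 k := by
  rw [tendsto_subtype_rng, tendsto_pi_nhds]
  refine forall_congr' fun k => ?_
  rw [nhds_discrete, tendsto_pure]
  rfl

/-- Rational integers that represent the components of an `m`-adic integer. -/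
theorem exists_intCast_eq (ξ : MadicInt m) :
    ∃ x : ℕ → ℤ, ∀ k, (x k : ZMod (m.natAbs ^ k)) = ξ.1 k :=
  Classical.skolem.1 fun k => ZMod.intCast_surjective (ξ.1 k)

theorem castHom_intCast {a b : ℕ} (h : a ∣ b) (z : ℤ) : ZMod.castHom h (ZMod a) (z : ZMod b) = z :=
  map_intCast _ _

/-- An integer that represents a component also represents the earlier ones. -/
theorem intCast_eq_of_le {ξ : MadicInt m} {x : ℤ} {h k : ℕ} (hk : h ≤ k)
    (hx : (x : ZMod (m.natAbs ^ k)) = ξ.1 k) : (x : ZMod (m.natAbs ^ h)) = ξ.1 h := by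
  rw [← ξ.2 h k hk, ← hx, castHom_intCast]

/-- The `m`-adic integer given by a sequence of integers that are compatible modulo `m ^ k`. -/
theorem exists_of_dvd {x : ℕ → ℤ} (hx : ∀ h k, h ≤ k → m ^ h ∣ x k - x h) :
    ∃ ξ : MadicInt m, ∀ k, ξ.1 k = x k :=
  ⟨⟨fun k => x k, fun h k hk => by
    rw [castHom_intCast]
    exact intCast_eq_iff_dvd.2 (hx h k hk)⟩, fun _ => rfl⟩

/-- Every `m`-adic integer is the limit of rational integers whose absolute values tend to
infinity. -/
theorem exists_tendsto (hm : m ≠ 0) (ξ : MadicInt m) :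
    ∃ x : ℕ → ℤ, Tendsto (fun i => (x i : MadicInt m)) atTop (𝓝 ξ) ∧
      Tendsto (fun i => |x i|) atTop atTop := by
  obtain ⟨x, hx⟩ := exists_intCast_eq ξ
  -- the summand `|m| ^ i * i` makes the absolute values grow, even if `|m| = 1`
  refine ⟨fun i => x i % m ^ i + |m| ^ i * i, tendsto_iff.2 fun k => ?_, ?_⟩
  · filter_upwards [eventually_ge_atTop k] with i hi
    refine intCast_eq_of_le hi ?_
    rw [← hx i, intCast_eq_iff_dvd]
    have h1 : m ^ i ∣ |m| ^ i := by
      rw [← abs_pow]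
      exact (dvd_abs _ _).2 dvd_rfl
    have h2 : m ^ i ∣ x i % m ^ i - x i := ⟨-(x i / m ^ i), by
      linear_combination Int.emod_add_mul_ediv (x i) (m ^ i)⟩
    convert! dvd_add h2 (h1.mul_right (i : ℤ)) using 1
    ring
  · refine tendsto_atTop_mono (fun i => ?_) tendsto_natCast_atTop_atTop
    have h1 := Int.emod_nonneg (x i) (pow_ne_zero i hm)
    have h2 : (1 : ℤ) ≤ |m| ^ i := one_le_pow₀ (Int.one_le_abs hm)
    have h3 : (i : ℤ) ≤ |m| ^ i * i := le_mul_of_one_le_left (by positivity) h2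
    exact (h3.trans (le_add_of_nonneg_left h1)).trans (le_abs_self _)

/-- An `m`-adic integer is congruent modulo `m` to the integers that represent its class in
`ℤ/mℤ`. -/
theorem exists_eq_add_mul (hm : m ≠ 0) (ξ : MadicInt m) {r : ℤ}
    (hr : (r : ZMod (m.natAbs ^ 1)) = ξ.1 1) : ∃ ζ : MadicInt m, ξ = r + m * ζ := by
  obtain ⟨x, hx⟩ := exists_intCast_eq ξ
  have h1 : ∀ k, ∃ z, x (k + 1) = r + m * z := by
    intro k
    have h2 := intCast_eq_of_le (show 1 ≤ k + 1 by omega) (hx (k + 1))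
    rw [← hr, intCast_eq_iff_dvd, pow_one] at h2
    obtain ⟨z, hz⟩ := h2
    exact ⟨z, by linear_combination hz⟩
  choose z hz using h1
  obtain ⟨ζ, hζ⟩ := exists_of_dvd (m := m) (x := z) fun h k hk => by
    have h2 := intCast_eq_of_le (show h + 1 ≤ k + 1 by omega) (hx (k + 1))
    rw [← hx (h + 1), intCast_eq_iff_dvd, hz, hz, pow_succ'] at h2
    refine Int.dvd_of_mul_dvd_mul_left hm ?_
    convert! h2 using 1
    ring
  refine ⟨ζ, ext fun k => ?_⟩
  have h2 := intCast_eq_of_le (Nat.le_succ k) (hx (k + 1))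
  rw [← h2, hz]
  push_cast
  change _ = ((r : MadicInt m).1 k) + (m : MadicInt m).1 k * ζ.1 k
  rw [hζ, intCast_apply, intCast_apply]

theorem tendsto_mul_left (d : ℤ) {x : ℕ → ℤ} {ξ : MadicInt m}
    (h : Tendsto (fun i => (x i : MadicInt m)) atTop (𝓝 ξ)) :
    Tendsto (fun i => ((d * x i : ℤ) : MadicInt m)) atTop (𝓝 (d * ξ)) := by
  rw [tendsto_iff] at h ⊢
  intro k
  filter_upwards [h k] with i hi
  rw [Int.cast_mul, hi]
  rfl

theorem tendsto_abs_mul_left {d : ℤ} (hd : d ≠ 0) {x : ℕ → ℤ}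
    (h : Tendsto (fun i => |x i|) atTop atTop) : Tendsto (fun i => |d * x i|) atTop atTop := by
  refine tendsto_atTop_mono (fun i => ?_) h
  rw [abs_mul]
  exact le_mul_of_one_le_left (abs_nonneg _) (Int.one_le_abs hd)

/-- Sequences of integers with limits in `ℤ_m` have equal limits in `ℤ_{m'}`, for a divisor `m'` of
`m`, if and only if they are eventually congruent modulo every power of `m'`. -/
theorem madicProj_eq_iff {m' : ℤ} (hm : m' ∣ m) {x y : ℕ → ℤ} {ξ η : MadicInt m}
    (hx : Tendsto (fun i => (x i : MadicInt m)) atTop (𝓝 ξ))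
    (hy : Tendsto (fun i => (y i : MadicInt m)) atTop (𝓝 η)) :
    madicProj hm ξ = madicProj hm η ↔ ∀ k, ∀ᶠ i in atTop, m' ^ k ∣ x i - y i := by
  have hcomp : ∀ {x : ℕ → ℤ} {ξ : MadicInt m},
      Tendsto (fun i => (x i : MadicInt m)) atTop (𝓝 ξ) → ∀ k, ∀ᶠ i in atTop,
        (madicProj hm ξ).1 k = x i := by
    intro x ξ hx k
    filter_upwards [tendsto_iff.1 hx k] with i hi
    change ZMod.castHom _ _ (ξ.1 k) = _
    rw [← hi, castHom_intCast]
  constructor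
  · intro h k
    filter_upwards [hcomp hx k, hcomp hy k] with i h1 h2
    rw [← intCast_eq_iff_dvd, ← h1, ← h2, h]
  · intro h
    refine ext fun k => ?_
    obtain ⟨i, h1, h2, h3⟩ := ((hcomp hx k).and ((hcomp hy k).and (h k))).exists
    rw [h1, h2, intCast_eq_iff_dvd]
    exact h3

end MadicInt

/-! ### The limits of Baumslag-Solitar groups -/

/-- If the terms of `x` and `y` are eventually congruent modulo every power of `m / d`, then a given
word is eventually trivial in both or none of `BS(m, d x_i)` and `BS(m, d y_i)`. -/
theorem eventually_mem_relations_iff {m d m' : ℤ} (hm : m ≠ 0) (hd : m = d * m') {x y : ℕ → ℤ}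
    (hxy : ∀ k, ∀ᶠ i in atTop, m' ^ k ∣ x i - y i)
    (hx : Tendsto (fun i => |d * x i|) atTop atTop) (hy : Tendsto (fun i => |d * y i|) atTop atTop)
    (w : FreeGroup (Fin 2)) :
    ∀ᶠ i in atTop, (w ∈ (BS m (d * x i)).relations ↔ w ∈ (BS m (d * y i)).relations) := by
  subst hd
  obtain ⟨H, B, h⟩ := exists_forall_mem_relations_iff w
  filter_upwards [hxy H, hx.eventually_gt_atTop B, hy.eventually_gt_atTop B] with i h1 h2 h3
    using h d m' _ _ hm h1 h2 h3

theorem MadicInt.eventually_dvd_sub {m : ℤ} {x y : ℕ → ℤ} {ξ : MadicInt m}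
    (hx : Tendsto (fun i => (x i : MadicInt m)) atTop (𝓝 ξ))
    (hy : Tendsto (fun i => (y i : MadicInt m)) atTop (𝓝 ξ)) (k : ℕ) :
    ∀ᶠ i in atTop, m ^ k ∣ x i - y i :=
  (madicProj_eq_iff dvd_rfl hx hy).1 rfl k

theorem exists_isBSLimit {m : ℤ} (hm : m ≠ 0) (ξ : MadicInt m) : ∃ G, IsBSLimit m ξ G := by
  obtain ⟨x, hx, hx'⟩ := MadicInt.exists_tendsto hm ξ
  obtain ⟨G, hG⟩ := MarkedGroupSpace.exists_tendsto (F := fun i => BS m (x i)) fun w => by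
    obtain ⟨H, B, h⟩ := exists_forall_mem_relations_iff w
    -- with common divisor `1`, a congruence modulo a power of `m` is what is needed
    obtain ⟨N, hN⟩ := eventually_atTop.1
      ((MadicInt.tendsto_iff.1 hx H).and (hx'.eventually_gt_atTop B))
    refine ⟨N, fun i hi j hj => ?_⟩
    have h1 := h 1 m (x i) (x j) (by simpa using hm)
      (MadicInt.intCast_eq_iff_dvd.1 ((hN i hi).1.trans (hN j hj).1.symm))
      (by simpa using (hN i hi).2) (by simpa using (hN j hj).2)
    simp only [one_mul] at h1
    exact h1.1
  refine ⟨G, fun y hy hy' => MarkedGroupSpace.tendsto_iff.2 fun w => ?_⟩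
  have h1 := eventually_mem_relations_iff hm (one_mul m).symm (MadicInt.eventually_dvd_sub hy hx)
    (by simpa using hy') (by simpa using hx') w
  filter_upwards [h1, MarkedGroupSpace.tendsto_iff.1 hG w] with i h1 h2
  rw [← h2]
  simpa using h1

theorem isBSLimit_BSbar {m : ℤ} (hm : m ≠ 0) (ξ : MadicInt m) : IsBSLimit m ξ (BSbar m ξ) :=
  Classical.epsilon_spec (exists_isBSLimit hm ξ)

/-- Two limits are equal if and only if every word is eventually trivial in both or none of the
approximating groups. -/
theorem BSbar_eq_iff {m : ℤ} (hm : m ≠ 0) {ξ η : MadicInt m} {x y : ℕ → ℤ}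
    (hx : Tendsto (fun i => (x i : MadicInt m)) atTop (𝓝 ξ))
    (hx' : Tendsto (fun i => |x i|) atTop atTop)
    (hy : Tendsto (fun i => (y i : MadicInt m)) atTop (𝓝 η))
    (hy' : Tendsto (fun i => |y i|) atTop atTop) :
    BSbar m ξ = BSbar m η ↔ ∀ w : FreeGroup (Fin 2), ∀ᶠ i in atTop,
      (w ∈ (BS m (x i)).relations ↔ w ∈ (BS m (y i)).relations) := by
  have h1 := isBSLimit_BSbar hm ξ x hx hx'
  have h2 := isBSLimit_BSbar hm η y hy hy'
  constructor
  · intro h w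
    filter_upwards [MarkedGroupSpace.tendsto_iff.1 h1 w, MarkedGroupSpace.tendsto_iff.1 h2 w]
      with i h3 h4
    rw [h3, h4, h]
  · intro h
    refine tendsto_nhds_unique h1 (MarkedGroupSpace.tendsto_iff.2 fun w => ?_)
    filter_upwards [h w, MarkedGroupSpace.tendsto_iff.1 h2 w] with i h3 h4
    rw [h3, h4]

/-- If every word is eventually trivial in both or none of `BS(m, x_i)` and `BS(m, y_i)`, then
Horner's scheme stays in the integers for common digits. -/
theorem eventually_exists_isHornerIntegral {m : ℤ} (hm : m ≠ 0) {x y : ℕ → ℤ}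
    (hx : Tendsto (fun i => |x i|) atTop atTop) (hy : Tendsto (fun i => |y i|) atTop atTop)
    (h : ∀ w : FreeGroup (Fin 2), ∀ᶠ i in atTop,
      (w ∈ (BS m (x i)).relations ↔ w ∈ (BS m (y i)).relations)) (k : ℕ) :
    ∀ᶠ i in atTop, ∃ c, IsHornerIntegral m (x i) c k ∧ IsHornerIntegral m (y i) c k := by
  -- only finitely many sequences of `k` digits have to be considered
  let digits : (Fin k → Fin m.natAbs) → ℕ → ℤ := fun f i =>
    if hi : i < k then (f ⟨i, hi⟩ : ℕ) else 0
  filter_upwards [Filter.eventually_all.2 fun f => h (hornerWord m (digits f) k),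
    hx.eventually_ge_atTop 2, hy.eventually_ge_atTop 2] with i hi hx hy
  obtain ⟨c, hc, hck⟩ := IsHornerIntegral.exists_digits hm (x i)
  have hlt : ∀ j, (c j).toNat < m.natAbs := fun j => by
    have := hc j
    rw [Int.abs_eq_natAbs] at this
    omega
  have hdig : ∀ j < k, c j = digits (fun j => ⟨(c j).toNat, hlt j⟩) j := by
    intro j hj
    simp only [digits, dif_pos hj]
    exact (Int.toNat_of_nonneg (hc j).1).symm
  have h1 := (hck k).congr hdig
  refine ⟨_, h1, ?_⟩
  have h2 := hi fun j => ⟨(c j).toNat, hlt j⟩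
  rw [MarkedBS.hornerWord_mem_relations_iff hm hx, MarkedBS.hornerWord_mem_relations_iff hm hy]
    at h2
  exact h2.1 h1

/-- The greatest common divisor of `ξ` and `m` is that of `r` and `m`, where `r` is an integer that
represents `ξ` modulo `m`. -/
theorem isMadicGcd_gcd {m : ℤ} (hm : m ≠ 0) {ξ : MadicInt m} {r : ℤ}
    (hr : (r : ZMod (m.natAbs ^ 1)) = ξ.1 1) :
    IsMadicGcd {ξ, (m : MadicInt m)} (Int.gcd r m) := by
  obtain ⟨ζ, rfl⟩ := MadicInt.exists_eq_add_mul hm ξ hr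
  refine ⟨Int.gcd_pos_of_ne_zero_right _ hm, fun p _ hp => ?_, ?_⟩
  · exact (Int.natCast_dvd_natCast.2 hp).trans (Int.gcd_dvd_right _ _)
  · apply le_antisymm
    · rw [Ideal.span_le]
      have h1 : ∀ z : ℤ, (Int.gcd r m : ℤ) ∣ z →
          (z : MadicInt m) ∈ Ideal.span {((Int.gcd r m : ℕ) : MadicInt m)} := by
        rintro _ ⟨z, rfl⟩
        rw [Ideal.mem_span_singleton]
        exact ⟨z, by push_cast; rfl⟩
      have h2 := h1 m (Int.gcd_dvd_right _ _)
      rintro _ (rfl | rfl)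
      · exact add_mem (h1 r (Int.gcd_dvd_left _ _)) (Ideal.mul_mem_right _ _ h2)
      · exact h2
    · rw [Ideal.span_singleton_le_iff_mem, Ideal.mem_span_pair]
      refine ⟨(Int.gcdA r m : ℤ), (Int.gcdB r m : ℤ) - (Int.gcdA r m : ℤ) * ζ, ?_⟩
      have h1 := congrArg (Int.cast : ℤ → MadicInt m) (Int.gcd_eq_gcd_ab r m)
      push_cast at h1
      linear_combination -h1

/-- For this direction any divisor `d` of `m` will do; it need not be the greatest common divisor
of `m` and `dξ`. -/
theorem BSbar_eq_of_madicProj_eq {m d m' : ℤ} (hm : m ≠ 0) (hd : m = d * m') (hm' : m' ∣ m)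
    {ξ η : MadicInt m} (h : madicProj hm' ξ = madicProj hm' η) :
    BSbar m (d * ξ) = BSbar m (d * η) := by
  have hd0 : d ≠ 0 := by rintro rfl; simp [hd] at hm
  obtain ⟨x, hx, hx'⟩ := MadicInt.exists_tendsto hm ξ
  obtain ⟨y, hy, hy'⟩ := MadicInt.exists_tendsto hm η
  have hx' := MadicInt.tendsto_abs_mul_left hd0 hx'
  have hy' := MadicInt.tendsto_abs_mul_left hd0 hy'
  rw [BSbar_eq_iff hm (MadicInt.tendsto_mul_left d hx) hx' (MadicInt.tendsto_mul_left d hy) hy']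
  exact eventually_mem_relations_iff hm hd ((MadicInt.madicProj_eq_iff hm' hx hy).1 h) hx' hy'

/-- Here `d` is the greatest common divisor of `m` and `dξ`. Hence the integers that approximate
`ξ` are coprime to `m'`, and the congruences between the approximations of `ξ` and `η` can be
improved one power of `m'` at a time. -/
theorem madicProj_eq_of_BSbar_eq {m d m' : ℤ} (hm : m ≠ 0) (hd : m = d * m') (hm' : m' ∣ m)
    {ξ η : MadicInt m} {r : ℤ} (hr : (r : ZMod (m.natAbs ^ 1)) = ((d : MadicInt m) * ξ).1 1)
    (hgcd : (Int.gcd r m : ℤ) = d) (h : BSbar m (d * ξ) = BSbar m (d * η)) :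
    madicProj hm' ξ = madicProj hm' η := by
  have hd0 : d ≠ 0 := by rintro rfl; simp [hd] at hm
  obtain ⟨x, hx, hx'⟩ := MadicInt.exists_tendsto hm ξ
  obtain ⟨y, hy, hy'⟩ := MadicInt.exists_tendsto hm η
  have hx' := MadicInt.tendsto_abs_mul_left hd0 hx'
  have hy' := MadicInt.tendsto_abs_mul_left hd0 hy'
  have hdx := MadicInt.tendsto_mul_left d hx
  rw [BSbar_eq_iff hm hdx hx' (MadicInt.tendsto_mul_left d hy) hy'] at h
  rw [MadicInt.madicProj_eq_iff hm' hx hy]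
  intro s
  induction s with
  | zero => simp
  | succ s ih =>
    filter_upwards [ih, eventually_exists_isHornerIntegral hm hx' hy' h (s + 1),
      MadicInt.tendsto_iff.1 hdx 1] with i h1 ⟨c, h2, h3⟩ h4
    rw [← hr, MadicInt.intCast_eq_iff_dvd, pow_one] at h4
    refine IsHornerIntegral.pow_succ_dvd_sub hd0 ?_ (hd ▸ h2) (hd ▸ h3) h1
    -- Bézout's identity for `r` and `m`, divided by `d`, shows that `m'` and `x i` are coprime
    obtain ⟨z, hz⟩ := h4
    have h5 := Int.gcd_eq_gcd_ab r m
    rw [hgcd] at h5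
    refine ⟨Int.gcdB r m - z * Int.gcdA r m, Int.gcdA r m, mul_left_cancel₀ hd0 ?_⟩
    rw [hd] at hz h5 ⊢
    linear_combination -h5 + Int.gcdA r (d * m') * hz

theorem MadicInt.not_isUnit_of_prime_dvd {m : ℤ} {p : ℕ} (hp : p.Prime) (hpm : (p : ℤ) ∣ m)
    {ξ : MadicInt m} (h : (p : MadicInt m) ∣ ξ) : ¬ IsUnit ξ := by
  intro hξ
  have h1 : IsUnit (p : MadicInt m) := isUnit_of_dvd_unit h hξ
  have h2 : IsUnit (p : ZMod (m.natAbs ^ 1)) :=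
    h1.map ((Pi.evalRingHom (fun k : ℕ => ZMod (m.natAbs ^ k)) 1).comp (madicSubring m).subtype)
  rw [pow_one, ZMod.isUnit_iff_coprime, Nat.Prime.coprime_iff_not_dvd hp] at h2
  exact h2 (Int.natCast_dvd.1 hpm)

theorem madicProj_injective_of_dvd {m m' : ℤ} (hm : m' ∣ m) (hm' : m ∣ m') :
    Function.Injective (madicProj hm) := by
  intro ξ η h
  obtain ⟨x, hx⟩ := MadicInt.exists_intCast_eq ξ
  obtain ⟨y, hy⟩ := MadicInt.exists_intCast_eq η
  refine MadicInt.ext fun k => ?_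
  have h1 := congrFun (congrArg Subtype.val h) k
  change ZMod.castHom _ _ (ξ.1 k) = ZMod.castHom _ _ (η.1 k) at h1
  rw [← hx k, ← hy k, MadicInt.castHom_intCast, MadicInt.castHom_intCast,
    MadicInt.intCast_eq_iff_dvd] at h1
  rw [← hx k, ← hy k, MadicInt.intCast_eq_iff_dvd]
  exact (pow_dvd_pow_of_dvd hm' k).trans h1

theorem BSbar_eq_BSbar_iff {m : ℤ} (hm : m ≠ 0) (ξ η : MadicInt m) :
    BSbar m ξ = BSbar m η ↔
      ∃ d : ℕ, IsMadicGcd {ξ, (m : MadicInt m)} d ∧ IsMadicGcd {η, (m : MadicInt m)} d ∧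
        ∃ hd : (d : ℤ) ∣ m, ∃ ξ' η' : MadicInt m, ξ = d * ξ' ∧ η = d * η' ∧
          madicProj (Int.ediv_dvd_of_dvd hd) ξ' = madicProj (Int.ediv_dvd_of_dvd hd) η' := by
  constructor
  · intro h
    obtain ⟨x, hx, hx'⟩ := MadicInt.exists_tendsto hm ξ
    obtain ⟨y, hy, hy'⟩ := MadicInt.exists_tendsto hm η
    obtain ⟨i, ⟨c, h1, h2⟩, hr, hq⟩ := ((eventually_exists_isHornerIntegral hm hx' hy'
      ((BSbar_eq_iff hm hx hx' hy hy').1 h) 1).and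
      ((MadicInt.tendsto_iff.1 hx 1).and (MadicInt.tendsto_iff.1 hy 1))).exists
    -- a single step of Horner's scheme already detects the residue modulo `m`
    have hgcd : Int.gcd (y i) m = Int.gcd (x i) m := by
      obtain ⟨z, hz⟩ := h1.dvd_sub_one h2
      rw [show x i = y i + m * z by linear_combination hz, Int.gcd_add_mul_left_left]
    have hξ := isMadicGcd_gcd hm hr
    have hη := isMadicGcd_gcd hm hq
    rw [hgcd] at hη
    have hdvd : ∀ {ζ : MadicInt m}, IsMadicGcd {ζ, (m : MadicInt m)} (Int.gcd (x i) m) →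
        ∃ ζ', ζ = (Int.gcd (x i) m : ℕ) * ζ' := by
      intro ζ hζ
      have h3 := Ideal.subset_span (s := {ζ, (m : MadicInt m)}) (Set.mem_insert _ _)
      rw [SetLike.mem_coe, hζ.2.2, Ideal.mem_span_singleton] at h3
      exact h3
    obtain ⟨ξ', hξ'⟩ := hdvd hξ
    obtain ⟨η', hη'⟩ := hdvd hη
    have hd : (Int.gcd (x i) m : ℤ) ∣ m := Int.gcd_dvd_right _ _
    refine ⟨_, hξ, hη, hd, ξ', η', hξ', hη', ?_⟩
    refine madicProj_eq_of_BSbar_eq hm (Int.mul_ediv_cancel' hd).symm _ (r := x i) ?_ rfl ?_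
    · rw [hr, Int.cast_natCast, ← hξ']
    · rw [Int.cast_natCast, ← hξ', ← hη', h]
  · rintro ⟨d, -, -, hd, ξ', η', rfl, rfl, h⟩
    have := BSbar_eq_of_madicProj_eq hm (Int.mul_ediv_cancel' hd).symm _ h
    rwa [Int.cast_natCast] at this

theorem eq_of_BSbar_eq {m : ℤ} (hm : m ≠ 0) {ξ η : MadicInt m}
    (hp : ¬ ∃ p : ℕ, p.Prime ∧ (p : ℤ) ∣ m ∧ (p : MadicInt m) ∣ ξ ∧ (p : MadicInt m) ∣ η)
    (h : BSbar m ξ = BSbar m η) : ξ = η := by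
  obtain ⟨d, hd1, -, hd, ξ', η', rfl, rfl, hproj⟩ := (BSbar_eq_BSbar_iff hm ξ η).1 h
  obtain rfl : d = 1 := by
    by_contra hne
    obtain ⟨p, hp1, hp2⟩ := Nat.exists_prime_and_dvd hne
    have hp3 : (p : MadicInt m) ∣ d := Nat.cast_dvd_cast hp2
    exact hp ⟨p, hp1, hd1.2.1 p hp1 hp2, hp3.mul_right _, hp3.mul_right _⟩
  exact congrArg _ (madicProj_injective_of_dvd _ (by simp) hproj)

theorem theorem2p1 (m : ℤ) (hm : m ≠ 0) :
    -- the limits exist, so that `BSbar m ξ` is what it is meant to be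
    (∀ ξ : MadicInt m, IsBSLimit m ξ (BSbar m ξ)) ∧
    -- the classification
    (∀ ξ η : MadicInt m, BSbar m ξ = BSbar m η ↔
      ∃ d : ℕ, IsMadicGcd {ξ, (m : MadicInt m)} d ∧ IsMadicGcd {η, (m : MadicInt m)} d ∧
        ∃ hd : (d : ℤ) ∣ m, ∃ ξ' η' : MadicInt m, ξ = d * ξ' ∧ η = d * η' ∧
          madicProj (Int.ediv_dvd_of_dvd hd) ξ' = madicProj (Int.ediv_dvd_of_dvd hd) η') ∧
    -- the consequences
    (∀ ξ η : MadicInt m, ξ ≠ η →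
      (¬ ∃ p : ℕ, p.Prime ∧ (p : ℤ) ∣ m ∧ (p : MadicInt m) ∣ ξ ∧ (p : MadicInt m) ∣ η) →
      BSbar m ξ ≠ BSbar m η) ∧
    Set.InjOn (BSbar m) {ξ : MadicInt m | IsUnit ξ} :=
  ⟨isBSLimit_BSbar hm, BSbar_eq_BSbar_iff hm, fun _ _ hne hp h => hne (eq_of_BSbar_eq hm hp h),
    fun _ hξ _ _ h => eq_of_BSbar_eq hm
      (fun ⟨_, hp1, hp2, hp3, _⟩ => MadicInt.not_isUnit_of_prime_dvd hp1 hp2 hp3 hξ) h⟩
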